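/- For $n\ge 2$ let $G_n$ be the straight linear 2-tree on $n$ vertices, i.e. the graph with vertex set $\{1,\dots,n\}$ in which $i$ and $j$ are adjacent if and only if $1\le |i-j|\le 2$. Put $m=n-2$. Let $r_m(i,j)$ denote the resistance distance between $i$ and $j$ in $G_n$ with unit resistance on every edge, that is, $r_m(i,j)=v_i-v_j$ for any $v\in\mathbb{R}^n$ with $Lv=e_i-e_j$, where $L$ is the Laplacian matrix of $G_n$. Theorem. Let $1\le j'\le j<j+k\le j'+k'\le n$ with $j,k,j',k'$ integers. Then $$r_m(j',j'+k')-r_m(j,j+k)\ge 0,$$ and the difference equals $0$ if and only if one of the following holds: (1) $j'=j$ and $k'=k$; (2) $j'=j=1$, $k=1$ and $k'=2$; (3) $j'=n-2$, $j=n-1$, $k=1$ and $k'=2$. Consequently, the maximal resistance distance in $G_n$ is $r_m(1,n)$: $r_m(a,b)\le r_m(1,n)$ for all vertices $a,b$ of $G_n$. -/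

import Mathlib

/-- The vertex set `{1, …, n}`. -/
abbrev Vert (n : ℕ) : Type := {i : ℕ // 1 ≤ i ∧ i ≤ n}

instance (n : ℕ) : Fintype (Vert n) :=
  Fintype.subtype (Finset.Icc 1 n) (by simp)

/-- The straight linear 2-tree `G_n`: the graph on `{1, …, n}` whose adjacency matrix is symmetric
with ones exactly on the first and second sub- and superdiagonals. -/
def straightLinear2Tree (n : ℕ) : SimpleGraph (Vert n) where
  Adj i j := i.1 + 1 = j.1 ∨ i.1 + 2 = j.1 ∨ j.1 + 1 = i.1 ∨ j.1 + 2 = i.1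
  symm := ⟨by intro i j h; omega⟩
  loopless := ⟨by intro i h; omega⟩

instance (n : ℕ) : DecidableRel (straightLinear2Tree n).Adj := fun i j =>
  inferInstanceAs (Decidable (i.1 + 1 = j.1 ∨ i.1 + 2 = j.1 ∨ j.1 + 1 = i.1 ∨ j.1 + 2 = i.1))

section Resistance

variable {V : Type*} [Fintype V] [DecidableEq V]

/-- `v` is a vector of potentials on the nodes of the circuit `G` (with unit resistance on each
edge) when one unit of current flows into node `i` and one unit flows out of node `j`:
Kirchhoff's and Ohm's laws, `L(G) v = e_i - e_j`. -/
def IsPotential (G : SimpleGraph V) [DecidableRel G.Adj] (i j : V) (v : V → ℝ) : Prop :=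
  (G.lapMatrix ℝ).mulVec v = Pi.single i 1 - Pi.single j 1

/-- The resistance distance `r_G(i, j)`: the potential difference `v_i - v_j` for any vector of
potentials `v`. On a connected graph such a `v` exists and the difference does not depend on its
choice, see `exists_isPotential` and `resistanceDistance_eq`. -/
noncomputable def resistanceDistance (G : SimpleGraph V) [DecidableRel G.Adj] (i j : V) : ℝ :=
  Classical.epsilon (IsPotential G i j) i - Classical.epsilon (IsPotential G i j) j

theorem exists_isPotential (G : SimpleGraph V) [DecidableRel G.Adj] (hG : G.Connected) (i j : V) :
    ∃ v, IsPotential G i j v := by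
  have hs : (Matrix.toEuclideanLin (G.lapMatrix ℝ)).IsSymmetric := by
    refine Matrix.isSymmetric_toEuclideanLin_iff.2 ?_
    exact G.isHermitian_lapMatrix ℝ
  set T := Matrix.toEuclideanLin (G.lapMatrix ℝ) with hT
  have hmem : WithLp.toLp 2 (Pi.single i (1 : ℝ) - Pi.single j 1) ∈ LinearMap.range T := by
    rw [← Submodule.orthogonal_orthogonal (LinearMap.range T), hs.orthogonal_range,
      Submodule.mem_orthogonal]
    intro u hu
    have hu' : (G.lapMatrix ℝ).mulVec u.ofLp = 0 := by
      have := congrArg WithLp.ofLp (LinearMap.mem_ker.1 hu)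
      simpa [hT, Matrix.toLpLin_apply] using this
    have := (G.lapMatrix_mulVec_eq_zero_iff_forall_reachable).1 hu' i j (hG.preconnected i j)
    simp [PiLp.inner_apply, sub_mul, Finset.sum_sub_distrib, this]
  obtain ⟨v, hv⟩ := hmem
  refine ⟨v.ofLp, ?_⟩
  have := congrArg WithLp.ofLp hv
  simpa [hT, Matrix.toLpLin_apply, IsPotential] using this

theorem resistanceDistance_eq (G : SimpleGraph V) [DecidableRel G.Adj] {i j : V} {v : V → ℝ}
    (hv : IsPotential G i j v) : resistanceDistance G i j = v i - v j := by
  have hw : IsPotential G i j (Classical.epsilon (IsPotential G i j)) :=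
    Classical.epsilon_spec ⟨v, hv⟩
  unfold resistanceDistance
  set w := Classical.epsilon (IsPotential G i j)
  have h0 : (G.lapMatrix ℝ).mulVec (w - v) = 0 := by
    rw [Matrix.mulVec_sub, hv, hw, sub_self]
  have h1 : dotProduct (w - v) ((G.lapMatrix ℝ).mulVec v) = 0 := by
    rw [Matrix.dotProduct_mulVec, ← Matrix.mulVec_transpose, (G.isSymm_lapMatrix (R := ℝ)).eq, h0,
      zero_dotProduct]
  rw [hv, dotProduct_sub, dotProduct_single, dotProduct_single] at h1
  simp only [Pi.sub_apply] at h1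
  linarith

end Resistance

theorem straightLinear2Tree_connected {n : ℕ} (hn : 1 ≤ n) :
    (straightLinear2Tree n).Connected := by
  have key : ∀ i (hi : 1 ≤ i ∧ i ≤ n),
      (straightLinear2Tree n).Reachable ⟨1, le_rfl, hn⟩ ⟨i, hi⟩ := by
    intro i hi
    obtain ⟨h1, h2⟩ := hi
    induction i, h1 using Nat.le_induction with
    | base => exact SimpleGraph.Reachable.refl _
    | succ i h1 ih =>
      refine (ih (by omega)).trans (SimpleGraph.Adj.reachable ?_)
      exact Or.inl rfl
  have : Nonempty (Vert n) := ⟨⟨1, le_rfl, hn⟩⟩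
  exact ⟨fun a b => (key a.1 a.2).symm.trans (key b.1 b.2)⟩

/-! ### Superposition, reciprocity and energy on a general graph. -/

section General

variable {V : Type*} [Fintype V] [DecidableEq V] {G : SimpleGraph V} [DecidableRel G.Adj]

/-! Moving one endpoint outward by one vertex changes the resistance by an amount readable from a
single potential `w`, driven through the edge from `b` to `b + 1` (`resistanceDistance_extend`). No
net current crosses a cut left of `b`, so the drops of `w` satisfy a three-term recurrence and are
odd-indexed Fibonacci numbers with alternating signs. Their partial sums are at most the last term,
and `2 F (2b-3) ≤ F (2b-1)`, strictly for `b ≥ 3`; hence the change is nonnegative and vanishes only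
from `(1, 2)` to `(1, 3)` (`alternating_recurrence`). Reflection handles the left endpoint, and
single steps add up. -/

theorem IsPotential.neg {i j : V} {v : V → ℝ} (h : IsPotential G i j v) :
    IsPotential G j i (-v) := by
  unfold IsPotential at *
  rw [Matrix.mulVec_neg, h, neg_sub]

theorem IsPotential.add {i j k : V} {v w : V → ℝ} (hv : IsPotential G i j v)
    (hw : IsPotential G j k w) : IsPotential G i k (v + w) := by
  unfold IsPotential at *
  rw [Matrix.mulVec_add, hv, hw, sub_add_sub_cancel]

/-- Reciprocity: the potential difference across `(k, l)` caused by a unit current through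
`(i, j)` equals the one across `(i, j)` caused by a unit current through `(k, l)`. -/
theorem IsPotential.reciprocity {i j k l : V} {v w : V → ℝ} (hv : IsPotential G i j v)
    (hw : IsPotential G k l w) : v k - v l = w i - w j := by
  have h : v ⬝ᵥ (G.lapMatrix ℝ).mulVec w = w ⬝ᵥ (G.lapMatrix ℝ).mulVec v := by
    rw [Matrix.dotProduct_mulVec, ← Matrix.mulVec_transpose, (G.isSymm_lapMatrix (R := ℝ)).eq,
      dotProduct_comm]
  rw [hv, hw, dotProduct_sub, dotProduct_sub] at h
  simpa using h

theorem resistanceDistance_self (i : V) : resistanceDistance G i i = 0 := by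
  simp [resistanceDistance]

theorem resistanceDistance_comm (hG : G.Connected) (i j : V) :
    resistanceDistance G i j = resistanceDistance G j i := by
  obtain ⟨v, hv⟩ := exists_isPotential G hG i j
  rw [resistanceDistance_eq G hv, resistanceDistance_eq G hv.neg]
  simp only [Pi.neg_apply]
  ring

/-- The drop is the dissipated energy `v ⬝ᵥ L v`, which vanishes only if `L v = 0`. -/
theorem IsPotential.sub_pos {i j : V} {v : V → ℝ} (hv : IsPotential G i j v) (hij : i ≠ j) :
    0 < v i - v j := by
  have hpsd := SimpleGraph.posSemidef_lapMatrix ℝ G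
  have henergy : v ⬝ᵥ (G.lapMatrix ℝ).mulVec v = v i - v j := by
    rw [hv, dotProduct_sub]
    simp
  rw [← henergy]
  refine lt_of_le_of_ne (by simpa using hpsd.dotProduct_mulVec_nonneg v) fun h => ?_
  have h0 := (hpsd.dotProduct_mulVec_zero_iff v).1 (by simpa using h.symm)
  rw [hv] at h0
  simpa [hij] using congrFun h0 i

theorem resistanceDistance_pos (hG : G.Connected) {i j : V} (hij : i ≠ j) :
    0 < resistanceDistance G i j := by
  obtain ⟨v, hv⟩ := exists_isPotential G hG i j
  rw [resistanceDistance_eq G hv]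
  exact hv.sub_pos hij

/-- If `v` drives current from `i` to `j`, then `v + w` drives it from `i` to `k`. Reciprocity turns
the cross term `v j - v k` into a second copy of `w i - w j`, so only `w` remains. -/
theorem resistanceDistance_extend (hG : G.Connected) {i j k : V} {w : V → ℝ}
    (hw : IsPotential G j k w) :
    resistanceDistance G i k - resistanceDistance G i j = (w j - w k) + 2 * (w i - w j) := by
  obtain ⟨v, hv⟩ := exists_isPotential G hG i j
  rw [resistanceDistance_eq G hv, resistanceDistance_eq G (hv.add hw)]
  have := hv.reciprocity hw
  simp only [Pi.add_apply]
  linarith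

theorem resistanceDistance_equiv (hG : G.Connected) (e : V ≃ V)
    (he : ∀ a b, G.Adj (e a) (e b) ↔ G.Adj a b) (i j : V) :
    resistanceDistance G (e i) (e j) = resistanceDistance G i j := by
  obtain ⟨v, hv⟩ := exists_isPotential G hG (e i) (e j)
  have h : IsPotential G i j (v ∘ e) := by
    have hdeg : ∀ a, G.degree (e a) = G.degree a := fun a => by
      rw [← SimpleGraph.card_neighborFinset_eq_degree, ← SimpleGraph.card_neighborFinset_eq_degree]
      exact (Finset.card_equiv e fun u => by simp [he]).symm
    funext a
    have ha := congrFun hv (e a)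
    rw [SimpleGraph.lapMatrix_mulVec_apply] at ha ⊢
    have hsum : ∑ u ∈ G.neighborFinset (e a), v u = ∑ u ∈ G.neighborFinset a, (v ∘ e) u := by
      refine (Finset.sum_equiv e (fun u => ?_) fun u _ => rfl).symm
      simp [he]
    rw [hsum, hdeg] at ha
    rw [Function.comp_apply, ha]
    simp [Pi.single_apply]
  rw [resistanceDistance_eq G hv, resistanceDistance_eq G h]
  rfl

end General

/-! ### The recurrence for the potential drops. -/

section AlternatingFibonacci

theorem exists_alternating_fib_sum {a m : ℕ} (ha : 1 ≤ a) (ham : a ≤ m) :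
    ∃ A : ℝ, ∑ s ∈ Finset.Ico a m, (-1 : ℝ) ^ (s + 1) * Nat.fib (2 * s - 1) = (-1) ^ m * A ∧
      0 ≤ A ∧ A ≤ Nat.fib (2 * (m - 1) - 1) ∧ (a = m → A = 0) ∧ (a + 1 = m → A = Nat.fib (2 * a - 1))
      := by
  induction m, ham using Nat.le_induction with
  | base => exact ⟨0, by simp⟩
  | succ m ham ih =>
    obtain ⟨A, hA, h0, h1, h2, -⟩ := ih
    have hmono : (Nat.fib (2 * (m - 1) - 1) : ℝ) ≤ Nat.fib (2 * m - 1) :=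
      Nat.cast_le.2 (Nat.fib_mono (by omega))
    -- Pulling out the sign of the newest term turns the sum into "new term minus old `A`";
    -- monotonicity keeps it between 0 and that term.
    refine ⟨Nat.fib (2 * m - 1) - A, ?_, by linarith, ?_, by omega, fun h => ?_⟩
    · rw [Finset.sum_Ico_succ_top ham, hA]
      ring
    · rw [Nat.add_sub_cancel]
      linarith
    · obtain rfl : a = m := by omega
      rw [h2 rfl, sub_zero]

/-- The explicit solution of the recurrence for the potential drops. -/
theorem eq_alternating_fib {u : ℕ → ℝ} {b : ℕ} (h2 : 2 ≤ b → 2 * u 1 + u 2 = 0)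
    (hrec : ∀ i, 1 ≤ i → i + 2 ≤ b → u i + 3 * u (i + 1) + u (i + 2) = 0) {i : ℕ} (hi : 1 ≤ i)
    (hib : i ≤ b) : u i = (-1) ^ (i + 1) * Nat.fib (2 * i - 1) * u 1 := by
  induction i using Nat.strong_induction_on with
  | _ i ih =>
    obtain rfl | rfl | ⟨k, rfl⟩ : i = 1 ∨ i = 2 ∨ ∃ k, i = k + 3 := by
      rcases i with _ | _ | _ | k
      · omega
      · simp
      · simp
      · exact Or.inr (Or.inr ⟨k, rfl⟩)
    · simp
    · have := h2 hib
      norm_num [Nat.fib_add_two]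
      linarith
    · have h := hrec (k + 1) (by omega) (by omega)
      rw [ih (k + 1) (by omega) (by omega) (by omega),
        ih (k + 1 + 1) (by omega) (by omega) (by omega)] at h
      rw [show 2 * (k + 1) - 1 = 2 * k + 1 by omega,
        show 2 * (k + 1 + 1) - 1 = 2 * k + 3 by omega] at h
      rw [show 2 * (k + 3) - 1 = 2 * k + 5 by omega]
      have e1 : Nat.fib (2 * k + 3) = Nat.fib (2 * k + 1) + Nat.fib (2 * k + 2) := Nat.fib_add_two
      have e2 : Nat.fib (2 * k + 4) = Nat.fib (2 * k + 2) + Nat.fib (2 * k + 3) := Nat.fib_add_two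
      have e3 : Nat.fib (2 * k + 5) = Nat.fib (2 * k + 3) + Nat.fib (2 * k + 4) := Nat.fib_add_two
      have e : (Nat.fib (2 * k + 5) : ℝ) = 3 * Nat.fib (2 * k + 3) - Nat.fib (2 * k + 1) := by
        rw [eq_sub_iff_add_eq]
        norm_cast
        omega
      rw [e]
      simp only [pow_succ] at h ⊢
      linear_combination h

theorem alternating_recurrence {u : ℕ → ℝ} {a b : ℕ} (ha : 1 ≤ a) (hab : a ≤ b)
    (h2 : 2 ≤ b → 2 * u 1 + u 2 = 0)
    (hrec : ∀ i, 1 ≤ i → i + 2 ≤ b → u i + 3 * u (i + 1) + u (i + 2) = 0) (hb : 0 < u b) :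
    0 ≤ u b + 2 * ∑ s ∈ Finset.Ico a b, u s ∧
      (u b + 2 * ∑ s ∈ Finset.Ico a b, u s = 0 ↔ a = 1 ∧ b = 2) := by
  obtain ⟨A, hA, h0, h1, heq, hsucc⟩ := exists_alternating_fib_sum ha hab
  -- The sign of `u 1` is unknown; `c` absorbs it and is positive because `u b` is.
  set c : ℝ := (-1) ^ (b + 1) * u 1 with hc
  have hub : u b = Nat.fib (2 * b - 1) * c := by
    rw [eq_alternating_fib h2 hrec (ha.trans hab) le_rfl, hc]
    ring
  have hcpos : 0 < c := by
    rw [hub] at hb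
    exact pos_of_mul_pos_right hb (Nat.cast_nonneg _)
  have hsum : ∑ s ∈ Finset.Ico a b, u s = -(c * A) := by
    have : ∑ s ∈ Finset.Ico a b, u s =
        (∑ s ∈ Finset.Ico a b, (-1 : ℝ) ^ (s + 1) * Nat.fib (2 * s - 1)) * u 1 := by
      rw [Finset.sum_mul]
      refine Finset.sum_congr rfl fun s hs => ?_
      rw [Finset.mem_Ico] at hs
      exact eq_alternating_fib h2 hrec (by omega) (by omega)
    rw [this, hA, hc]
    ring
  have hval : u b + 2 * ∑ s ∈ Finset.Ico a b, u s = c * (Nat.fib (2 * b - 1) - 2 * A) := by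
    rw [hub, hsum]
    ring
  rw [hval]
  by_cases h12 : a = 1 ∧ b = 2
  · obtain ⟨rfl, rfl⟩ := h12
    rw [hsucc rfl]
    norm_num [Nat.fib_add_two]
  · have hpos : (0 : ℝ) < Nat.fib (2 * b - 1) - 2 * A := by
      rcases hab.eq_or_lt with rfl | hlt
      · rw [heq rfl]
        have : 0 < Nat.fib (2 * a - 1) := Nat.fib_pos.2 (by omega)
        simpa using this
      -- Here `b ≥ 3`, and the gap `F (2b-1) - 2 F (2b-3) = F (2b-4)` is positive.
      · obtain ⟨k, rfl⟩ : ∃ k, b = k + 3 := ⟨b - 3, by omega⟩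
        rw [show 2 * (k + 3 - 1) - 1 = 2 * k + 3 by omega] at h1
        rw [show 2 * (k + 3) - 1 = 2 * k + 5 by omega]
        have e2 : Nat.fib (2 * k + 4) = Nat.fib (2 * k + 2) + Nat.fib (2 * k + 3) := Nat.fib_add_two
        have e3 : Nat.fib (2 * k + 5) = Nat.fib (2 * k + 3) + Nat.fib (2 * k + 4) := Nat.fib_add_two
        have e4 : 0 < Nat.fib (2 * k + 2) := Nat.fib_pos.2 (by omega)
        have e : (2 * Nat.fib (2 * k + 3) : ℝ) < Nat.fib (2 * k + 5) := by
          norm_cast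
          omega
        linarith
    have := mul_pos hcpos hpos
    exact ⟨this.le, iff_of_false this.ne' h12⟩

end AlternatingFibonacci

/-! ### Resistance monotonicity in the straight linear 2-tree. -/

section StraightLinear2Tree

variable {n : ℕ}

theorem lapMatrix_mulVec_straightLinear2Tree (W : ℕ → ℝ) (i : Vert n) (T : Finset ℕ)
    (hT : ∀ t, t ∈ T ↔ (1 ≤ t ∧ t ≤ n) ∧
      (i.1 + 1 = t ∨ i.1 + 2 = t ∨ t + 1 = i.1 ∨ t + 2 = i.1)) :
    (((straightLinear2Tree n).lapMatrix ℝ).mulVec fun x => W x.1) i = ∑ t ∈ T, (W i.1 - W t) := by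
  have hmap : ((straightLinear2Tree n).neighborFinset i).map (Function.Embedding.subtype _) = T := by
    ext t
    rw [hT]
    simp only [Finset.mem_map, SimpleGraph.mem_neighborFinset, Function.Embedding.subtype_apply]
    constructor
    · rintro ⟨x, hx, rfl⟩
      exact ⟨x.2, hx⟩
    · rintro ⟨h, hx⟩
      exact ⟨⟨t, h⟩, hx, rfl⟩
  rw [SimpleGraph.lapMatrix_mulVec_apply, ← hmap, Finset.sum_map, Finset.sum_sub_distrib]
  simp

/-- Kirchhoff's laws in `G_n`, summed over the vertices `1, …, i`: no current crosses the cut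
between `i` and `i + 1` when `i` lies to the left of the source. -/
theorem IsPotential.cut_current {W : ℕ → ℝ} {b : ℕ} {hb : 1 ≤ b ∧ b ≤ n}
    {hb' : 1 ≤ b + 1 ∧ b + 1 ≤ n}
    (hW : IsPotential (straightLinear2Tree n) ⟨b, hb⟩ ⟨b + 1, hb'⟩ fun x => W x.1) :
    (2 ≤ b → 2 * (W 1 - W 2) + (W 2 - W 3) = 0) ∧
    ∀ i, 1 ≤ i → i + 2 ≤ b →
      (W i - W (i + 1)) + 3 * (W (i + 1) - W (i + 1 + 1)) + (W (i + 2) - W (i + 2 + 1)) = 0 := by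
  have hrow : ∀ i (T : Finset ℕ) (hi : 1 ≤ i ∧ i ≤ n), i < b →
      (∀ t, t ∈ T ↔ (1 ≤ t ∧ t ≤ n) ∧ (i + 1 = t ∨ i + 2 = t ∨ t + 1 = i ∨ t + 2 = i)) →
      ∑ t ∈ T, (W i - W t) = 0 := by
    intro i T hi hib hT
    rw [← lapMatrix_mulVec_straightLinear2Tree W ⟨i, hi⟩ T hT, hW]
    have h1 : i ≠ b := by omega
    have h2 : i ≠ b + 1 := by omega
    simp [h1, h2]
  have h1 : 2 ≤ b → 2 * (W 1 - W 2) + (W 2 - W 3) = 0 := fun h => by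
    have := hrow 1 {2, 3} (by omega) (by omega) (by simp; omega)
    rw [Finset.sum_pair (by norm_num)] at this
    linarith
  refine ⟨h1, fun i hi => ?_⟩
  induction i, hi using Nat.le_induction with
  | base =>
    intro h
    have := hrow 2 {1, 3, 4} (by omega) (by omega) (by simp; omega)
    rw [Finset.sum_insert (by norm_num), Finset.sum_pair (by norm_num)] at this
    have := h1 (by omega)
    norm_num
    linarith
  | succ i hi ih =>
    intro h
    -- Adding Kirchhoff's law at `i + 2` to the previous cut equation moves the cut one vertex to
    -- the right.
    have := hrow (i + 2) {i, i + 1, i + 3, i + 4} (by omega) (by omega) (by simp; omega)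
    rw [Finset.sum_insert (by simp), Finset.sum_insert (by simp),
      Finset.sum_pair (by omega)] at this
    have := ih (by omega)
    simp only [add_assoc, Nat.reduceAdd] at *
    linarith

theorem resistanceDistance_le_succ {a b : ℕ} (ha : 1 ≤ a) (hab : a ≤ b) (hb : b + 1 ≤ n) :
    0 ≤ resistanceDistance (straightLinear2Tree n) ⟨a, ha, by omega⟩ ⟨b + 1, by omega, hb⟩ -
        resistanceDistance (straightLinear2Tree n) ⟨a, ha, by omega⟩ ⟨b, by omega, by omega⟩ ∧
      (resistanceDistance (straightLinear2Tree n) ⟨a, ha, by omega⟩ ⟨b + 1, by omega, hb⟩ -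
        resistanceDistance (straightLinear2Tree n) ⟨a, ha, by omega⟩ ⟨b, by omega, by omega⟩ = 0 ↔
        a = 1 ∧ b = 2) := by
  have hG := straightLinear2Tree_connected (n := n) (by omega)
  obtain ⟨w, hw⟩ := exists_isPotential _ hG (⟨b, by omega, by omega⟩ : Vert n)
    ⟨b + 1, by omega, hb⟩
  -- Extending by zero lets the drops be indexed by natural numbers; values outside `1, …, n` are
  -- never used.
  obtain ⟨W, rfl⟩ : ∃ W : ℕ → ℝ, w = fun x => W x.1 := by
    refine ⟨fun i => if h : 1 ≤ i ∧ i ≤ n then w ⟨i, h⟩ else 0, ?_⟩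
    funext x
    simp [x.2.1, x.2.2]
  obtain ⟨h2, hrec⟩ := hw.cut_current
  rw [resistanceDistance_extend hG hw]
  have hpos := hw.sub_pos (by simp)
  have hsum : W a - W b = ∑ s ∈ Finset.Ico a b, (W s - W (s + 1)) := by
    rw [← neg_inj, neg_sub, ← Finset.sum_Ico_sub W hab, ← Finset.sum_neg_distrib]
    simp
  have := alternating_recurrence (u := fun s => W s - W (s + 1)) ha hab h2 hrec hpos
  simpa only [hsum] using this

/-- The reflection `i ↦ n + 1 - i` of `G_n`. -/
def Vert.rev (n : ℕ) : Vert n ≃ Vert n where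
  toFun i := ⟨n + 1 - i.1, by have := i.2; omega⟩
  invFun i := ⟨n + 1 - i.1, by have := i.2; omega⟩
  left_inv i := Subtype.ext (by have := i.2; simp only; omega)
  right_inv i := Subtype.ext (by have := i.2; simp only; omega)

theorem resistanceDistance_reflect {a b a' b' : ℕ} (ha : 1 ≤ a ∧ a ≤ n) (hb : 1 ≤ b ∧ b ≤ n)
    (ha' : 1 ≤ a' ∧ a' ≤ n) (hb' : 1 ≤ b' ∧ b' ≤ n) (hab : a + b' = n + 1) (hba : b + a' = n + 1) :
    resistanceDistance (straightLinear2Tree n) ⟨a', ha'⟩ ⟨b', hb'⟩ =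
      resistanceDistance (straightLinear2Tree n) ⟨a, ha⟩ ⟨b, hb⟩ := by
  have hG := straightLinear2Tree_connected (n := n) (by omega)
  rw [resistanceDistance_comm hG, ← resistanceDistance_equiv hG (Vert.rev n)]
  · congr 2
    · simp only [Vert.rev, Equiv.coe_fn_mk, Subtype.mk.injEq]; omega
    · simp only [Vert.rev, Equiv.coe_fn_mk, Subtype.mk.injEq]; omega
  · intro a b
    have := a.2
    have := b.2
    simp only [Vert.rev, straightLinear2Tree, Equiv.coe_fn_mk]
    omega

theorem resistanceDistance_le_pred {a b : ℕ} (ha : 1 ≤ a) (hab : a + 1 ≤ b) (hb : b ≤ n) :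
    0 ≤ resistanceDistance (straightLinear2Tree n) ⟨a, ha, by omega⟩ ⟨b, by omega, hb⟩ -
        resistanceDistance (straightLinear2Tree n) ⟨a + 1, by omega, by omega⟩
          ⟨b, by omega, hb⟩ ∧
      (resistanceDistance (straightLinear2Tree n) ⟨a, ha, by omega⟩ ⟨b, by omega, hb⟩ -
        resistanceDistance (straightLinear2Tree n) ⟨a + 1, by omega, by omega⟩
          ⟨b, by omega, hb⟩ = 0 ↔ b = n ∧ a + 2 = n) := by
  have h := resistanceDistance_le_succ (n := n) (a := n + 1 - b) (b := n - a) (by omega)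
    (by omega) (by omega)
  rw [resistanceDistance_reflect (n := n) (a := a) (b := b) (a' := n + 1 - b) (b' := n - a + 1)
      ⟨ha, by omega⟩ ⟨by omega, hb⟩ (by omega) (by omega) (by omega) (by omega),
    resistanceDistance_reflect (n := n) (a := a + 1) (b := b) (a' := n + 1 - b) (b' := n - a)
      (by omega) ⟨by omega, hb⟩ (by omega) (by omega) (by omega) (by omega)] at h
  refine ⟨h.1, h.2.trans ?_⟩
  omega

/-- A sum of nonnegative increments vanishes only if each does, and only the increment from 2 to 3
with `a = 1` can. -/
theorem resistanceDistance_extend_right {a b c : ℕ} (ha : 1 ≤ a) (hab : a < b) (hbc : b ≤ c)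
    (hc : c ≤ n) :
    0 ≤ resistanceDistance (straightLinear2Tree n) ⟨a, ha, by omega⟩ ⟨c, by omega, hc⟩ -
        resistanceDistance (straightLinear2Tree n) ⟨a, ha, by omega⟩ ⟨b, by omega, by omega⟩ ∧
      (resistanceDistance (straightLinear2Tree n) ⟨a, ha, by omega⟩ ⟨c, by omega, hc⟩ -
        resistanceDistance (straightLinear2Tree n) ⟨a, ha, by omega⟩ ⟨b, by omega, by omega⟩ = 0 ↔
        b = c ∨ a = 1 ∧ b = 2 ∧ c = 3) := by
  induction c, hbc using Nat.le_induction with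
  | base => simp
  | succ c hbc ih =>
    obtain ⟨ih1, ih2⟩ := ih (by omega)
    obtain ⟨h1, h2⟩ := resistanceDistance_le_succ (n := n) ha (hab.le.trans hbc) hc
    refine ⟨by linarith, fun h => ?_, fun h => ?_⟩
    · have := ih2.1 (by linarith)
      have := h2.1 (by linarith)
      omega
    · have := ih2.2 (by omega)
      have := h2.2 (by omega)
      linarith

theorem resistanceDistance_extend_left {a b c : ℕ} (ha : 1 ≤ a) (hab : a ≤ b) (hbc : b < c)
    (hc : c ≤ n) :
    0 ≤ resistanceDistance (straightLinear2Tree n) ⟨a, ha, by omega⟩ ⟨c, by omega, hc⟩ -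
        resistanceDistance (straightLinear2Tree n) ⟨b, by omega, by omega⟩ ⟨c, by omega, hc⟩ ∧
      (resistanceDistance (straightLinear2Tree n) ⟨a, ha, by omega⟩ ⟨c, by omega, hc⟩ -
        resistanceDistance (straightLinear2Tree n) ⟨b, by omega, by omega⟩ ⟨c, by omega, hc⟩ = 0 ↔
        a = b ∨ a + 2 = n ∧ b + 1 = n ∧ c = n) := by
  induction b, hab using Nat.le_induction with
  | base => simp
  | succ b hab ih =>
    obtain ⟨ih1, ih2⟩ := ih (by omega)
    obtain ⟨h1, h2⟩ := resistanceDistance_le_pred (n := n) (ha.trans hab) hbc.le hc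
    refine ⟨by linarith, fun h => ?_, fun h => ?_⟩
    · have := ih2.1 (by linarith)
      have := h2.1 (by linarith)
      omega
    · have := ih2.2 (by omega)
      have := h2.2 (by omega)
      linarith

theorem resistanceDistance_le_of_lt {a b : ℕ} (ha : 1 ≤ a) (hab : a < b) (hb : b ≤ n) :
    resistanceDistance (straightLinear2Tree n) ⟨a, ha, by omega⟩ ⟨b, by omega, hb⟩ ≤
      resistanceDistance (straightLinear2Tree n) ⟨1, le_rfl, by omega⟩ ⟨n, by omega, le_rfl⟩ := by
  have h1 := (resistanceDistance_extend_right (n := n) ha hab hb le_rfl).1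
  have h2 := (resistanceDistance_extend_left (n := n) le_rfl ha (hab.trans_le hb) le_rfl).1
  linarith

end StraightLinear2Tree

theorem mainTheorem7 (n : ℕ) (hn : 2 ≤ n) :
    (∀ (j k j' k' : ℕ) (h1 : 1 ≤ j') (h2 : j' ≤ j) (h3 : j < j + k) (h4 : j + k ≤ j' + k')
        (h5 : j' + k' ≤ n),
      0 ≤ resistanceDistance (straightLinear2Tree n)
            ⟨j', h1, by omega⟩ ⟨j' + k', by omega, h5⟩
          - resistanceDistance (straightLinear2Tree n)
            ⟨j, by omega, by omega⟩ ⟨j + k, by omega, by omega⟩ ∧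
      (resistanceDistance (straightLinear2Tree n)
            ⟨j', h1, by omega⟩ ⟨j' + k', by omega, h5⟩
          - resistanceDistance (straightLinear2Tree n)
            ⟨j, by omega, by omega⟩ ⟨j + k, by omega, by omega⟩ = 0 ↔
        (j' = j ∧ k' = k) ∨
        (j' = 1 ∧ j = 1 ∧ k = 1 ∧ k' = 2) ∨
        (j' + 2 = n ∧ j + 1 = n ∧ k = 1 ∧ k' = 2))) ∧
    IsGreatest (Set.range fun p : Vert n × Vert n =>
        resistanceDistance (straightLinear2Tree n) p.1 p.2)
      (resistanceDistance (straightLinear2Tree n)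
        ⟨1, le_rfl, by omega⟩ ⟨n, by omega, le_rfl⟩) := by
  refine ⟨fun j k j' k' h1 h2 h3 h4 h5 => ?_, ⟨⟨(⟨1, le_rfl, by omega⟩, ⟨n, by omega, le_rfl⟩), rfl⟩, ?_⟩⟩
  -- Pass through the intermediate pair `(j, j' + k')`. The two exceptional equalities cannot occur
  -- together, as they would need `n = 3` and `n = 2`.
  · obtain ⟨r1, r2⟩ := resistanceDistance_extend_right (n := n) (h1.trans h2) h3 h4 h5
    obtain ⟨l1, l2⟩ := resistanceDistance_extend_left (n := n) h1 h2 (h3.trans_le h4) h5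
    refine ⟨by linarith, fun h => ?_, fun h => ?_⟩
    · have := r2.1 (by linarith)
      have := l2.1 (by linarith)
      omega
    · have := r2.2 (by omega)
      have := l2.2 (by omega)
      linarith
  · have hG := straightLinear2Tree_connected (n := n) (by omega)
    rintro _ ⟨⟨⟨a, ha, han⟩, ⟨b, hb, hbn⟩⟩, rfl⟩
    rcases lt_trichotomy a b with hab | rfl | hab
    · exact resistanceDistance_le_of_lt ha hab hbn
    · simp only [resistanceDistance_self]
      exact (resistanceDistance_pos hG (by simp; omega)).le
    · simp only
      rw [resistanceDistance_comm hG]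
      exact resistanceDistance_le_of_lt hb hab han
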